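/- Let $n, p$ be non-negative integers. For real matrices $A \in \mathbb{R}^{n\times n}$, $B\in\mathbb{R}^{n\times m}$ and $c \in \mathbb{R}^{n\times p}$, the pair $(A,B)$ is called controllable if the controllability matrix $[B, AB, \dots, A^{n-1}B]$ has rank $n$, and the pair $(A,c)$ is called observable if the matrix with block rows $c^\top, c^\top A, \dots, c^\top A^{n-1}$ has rank $n$. Let $\mathcal{X}$ be the set of triplets $(A,c,P)$ with $A \in \mathbb{R}^{n\times n}$, $c \in \mathbb{R}^{n\times p}$, $(A,c)$ observable and $P\in\mathbb{R}^{n\times n}$ symmetric positive definite, equipped with the subspace topology inherited from $\mathbb{R}^{n\times n}\times\mathbb{R}^{n\times p}\times\mathbb{R}^{n\times n}$. A triplet $(A,c,P)\in\mathcal{X}$ is called regular if there is a number $r>0$ such that the pair $(A,\Sigma c)$ is controllable, where $\Sigma$ is the unique symmetric positive definite solution of the algebraic Riccati equation $$A\Sigma+\Sigma A^\top - r\,\Sigma c c^\top \Sigma + P = 0.$$ Let $\mathcal{X}_{\rm reg}\subset\mathcal{X}$ be the set of regular triplets. Then $\mathcal{X}_{\rm reg}$ is open and dense in $\mathcal{X}$.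 -/

import Mathlib

/-- The controllability matrix `[B, A B, …, A ^ (n - 1) B]` of a pair `(A, B)`. -/
def controllabilityMatrix {n m : ℕ} (A : Matrix (Fin n) (Fin n) ℝ)
    (B : Matrix (Fin n) (Fin m) ℝ) : Matrix (Fin n) (Fin n × Fin m) ℝ :=
  Matrix.of fun i q => (A ^ (q.1 : ℕ) * B) i q.2

/-- The pair `(A, B)`, i.e. the system `x' = A x + B u`, is controllable: its controllability
matrix has full rank. -/
def IsControllablePair {n m : ℕ} (A : Matrix (Fin n) (Fin n) ℝ)
    (B : Matrix (Fin n) (Fin m) ℝ) : Prop :=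
  (controllabilityMatrix A B).rank = n

/-- The observability matrix, with blocks `cᵀ, cᵀ A, …, cᵀ A ^ (n - 1)`, of the system
`x' = A x`, `y = cᵀ x`. The columns of `c` are the observation vectors. -/
def observabilityMatrix {n p : ℕ} (A : Matrix (Fin n) (Fin n) ℝ)
    (c : Matrix (Fin n) (Fin p) ℝ) : Matrix (Fin n × Fin p) (Fin n) ℝ :=
  Matrix.of fun q i => (c.transpose * A ^ (q.1 : ℕ)) q.2 i

/-- The pair `(A, c)`, i.e. the system `x' = A x`, `y = cᵀ x`, is observable: its observability
matrix has full rank. -/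
def IsObservablePair {n p : ℕ} (A : Matrix (Fin n) (Fin n) ℝ)
    (c : Matrix (Fin n) (Fin p) ℝ) : Prop :=
  (observabilityMatrix A c).rank = n

/-- `S` is a positive definite (in particular symmetric) solution of the algebraic Riccati
equation `A S + S Aᵀ - r S c cᵀ S + P = 0`. -/
def IsPosDefRiccatiSolution {n p : ℕ} (A : Matrix (Fin n) (Fin n) ℝ)
    (c : Matrix (Fin n) (Fin p) ℝ) (P : Matrix (Fin n) (Fin n) ℝ) (r : ℝ)
    (S : Matrix (Fin n) (Fin n) ℝ) : Prop :=
  S.PosDef ∧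
    A * S + S * A.transpose - r • (S * c * c.transpose * S) + P = 0

/-- The triplets `(A, c, P)` with `(A, c)` observable and `P` positive definite. -/
def observableTriplets (n p : ℕ) :
    Set (Matrix (Fin n) (Fin n) ℝ × Matrix (Fin n) (Fin p) ℝ × Matrix (Fin n) (Fin n) ℝ) :=
  {x | IsObservablePair x.1 x.2.1 ∧ x.2.2.PosDef}

/-- The regular triplets `(A, c, P)`: `(A, c)` is observable, `P` is positive definite, and for
some `r > 0` the pair `(A, S c)` is controllable, where `S` is the unique positive definite
solution of the Riccati equation. -/
def regularTriplets (n p : ℕ) :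
    Set (Matrix (Fin n) (Fin n) ℝ × Matrix (Fin n) (Fin p) ℝ × Matrix (Fin n) (Fin n) ℝ) :=
  {x | x ∈ observableTriplets n p ∧
    ∃ r : ℝ, 0 < r ∧ ∃ S : Matrix (Fin n) (Fin n) ℝ,
      IsPosDefRiccatiSolution x.1 x.2.1 x.2.2 r S ∧
      (∀ T, IsPosDefRiccatiSolution x.1 x.2.1 x.2.2 r T → T = S) ∧
      IsControllablePair x.1 (S * x.2.1)}

/-! Write `C = r c cᵀ`. A positive definite solution `S` supplies a Lyapunov inequality for its own
closed loop `A - S C`, so the Sylvester operator built from two closed loops is injective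
(`sylvester_eq_zero`). Applied to the difference of two solutions, this gives uniqueness. Applied to
the derivative of the Riccati expression in `S`, it gives local solvability by the inverse function
theorem (`riccati_eventually_exists`). Since controllability is an open condition, openness follows
with `r` kept fixed.

For density, a solution `S` with `r = 1` comes from a continuity method in which observability rules
out blow-up (`IsObservablePair.exists_riccati`). Now `A` and `S` may be perturbed freely, `P` being
whatever the equation dictates. Move along the segment from `(A, S)` to `(Aᵀ, 1)`: at its far end
the pair is `(Aᵀ, c)`, controllable by duality. Controllability is the nonvanishing of an analytic
function of `t`, so it holds for all small `t ≠ 0`, where the dictated `P` is still positive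
definite. -/

open Matrix Filter Topology

/-! ### Sylvester operators, uniqueness and local solvability of the Riccati equation -/

section RiccatiLemmas

variable {ι κ : Type*} [Fintype ι]

/-- A positive semidefinite `W` annihilates every `V` with `Vᵀ W V = 0`. -/
theorem Matrix.PosSemidef.mul_eq_zero_of_transpose_mul_mul [DecidableEq ι] {W : Matrix ι ι ℝ}
    (hW : W.PosSemidef) {V : Matrix ι κ ℝ} (h : Vᵀ * W * V = 0) : W * V = 0 := by
  ext i j
  have h1 : star (fun k => V k j) ⬝ᵥ (W *ᵥ (fun k => V k j)) = 0 := by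
    have := congrFun (congrFun h j) j
    rw [Matrix.mul_assoc, Matrix.mul_apply] at this
    simpa [dotProduct, mulVec, Matrix.mul_apply] using this
  have h2 := congrFun ((hW.dotProduct_mulVec_zero_iff _).1 h1) i
  simpa [mulVec, dotProduct, Matrix.mul_apply] using h2

theorem Matrix.PosDef.eq_zero_of_transpose_mul_mul [DecidableEq ι] {W : Matrix ι ι ℝ}
    (hW : W.PosDef) {V : Matrix ι κ ℝ} (h : Vᵀ * W * V = 0) : V = 0 := by
  have h1 := hW.posSemidef.mul_eq_zero_of_transpose_mul_mul h
  have hu := (Matrix.isUnit_iff_isUnit_det _).1 hW.isUnit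
  rw [← Matrix.nonsing_inv_mul_cancel_left W V hu, h1, Matrix.mul_zero]

theorem Matrix.PosSemidef.exists_eq_transpose_mul_self [DecidableEq ι] {W : Matrix ι ι ℝ}
    (hW : W.PosSemidef) : ∃ K : Matrix ι ι ℝ, W = Kᵀ * K := by
  open scoped MatrixOrder in
  obtain ⟨K, hK⟩ := CStarAlgebra.nonneg_iff_eq_star_mul_self.mp hW.nonneg
  exact ⟨K, by simpa [star_eq_conjTranspose] using hK⟩

theorem Matrix.PosSemidef.transpose_mul_mul [Finite κ] {W : Matrix ι ι ℝ}
    (hW : W.PosSemidef) (V : Matrix ι κ ℝ) : (Vᵀ * W * V).PosSemidef := by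
  simpa using hW.conjTranspose_mul_mul_same V

theorem Matrix.PosSemidef.trace_mul_nonneg [DecidableEq ι] {W Q : Matrix ι ι ℝ}
    (hW : W.PosSemidef) (hQ : Q.PosSemidef) : 0 ≤ (W * Q).trace := by
  obtain ⟨K, rfl⟩ := hQ.exists_eq_transpose_mul_self
  have h := (hW.transpose_mul_mul Kᵀ).trace_nonneg
  rwa [Matrix.transpose_transpose, Matrix.trace_mul_comm, ← Matrix.mul_assoc,
    Matrix.trace_mul_comm] at h

/-- Injectivity of the Sylvester operator `D ↦ M D + D Nᵀ` when both coefficients admit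
quadratic Lyapunov functions. -/
theorem sylvester_eq_zero [DecidableEq ι] {S T M N D : Matrix ι ι ℝ} (hS : S.PosDef)
    (hT : T.PosDef) (hM : (-(M * S + S * Mᵀ)).PosDef) (hN : (-(N * T + T * Nᵀ)).PosDef)
    (h : M * D + D * Nᵀ = 0) : D = 0 := by
  have hSu := (Matrix.isUnit_iff_isUnit_det _).1 hS.isUnit
  have hTu := (Matrix.isUnit_iff_isUnit_det _).1 hT.isUnit
  have hS' := hS.inv
  have hT' := hT.inv
  have eS : S⁻¹ᵀ = S⁻¹ := by simpa using hS'.isHermitian.eq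
  have eT : T⁻¹ᵀ = T⁻¹ := by simpa using hT'.isHermitian.eq
  obtain ⟨K, hK⟩ := hT'.posSemidef.exists_eq_transpose_mul_self
  set U := S⁻¹ with hU
  set V := T⁻¹ with hV
  have hUS : U * S = 1 := Matrix.nonsing_inv_mul _ hSu
  have hSU : S * U = 1 := Matrix.mul_nonsing_inv _ hSu
  have hVT : V * T = 1 := Matrix.nonsing_inv_mul _ hTu
  have hTV : T * V = 1 := Matrix.mul_nonsing_inv _ hTu
  have hinj : ∀ {S U : Matrix ι ι ℝ}, S * U = 1 → Function.Injective U.mulVec := by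
    intro S U h x y hxy
    simpa [Matrix.mulVec_mulVec, h] using congrArg (S *ᵥ ·) hxy
  have hQ1 : (-(U * M + Mᵀ * U)).PosDef := by
    have := hM.conjTranspose_mul_mul_same (B := U) (hinj hSU)
    convert this using 1
    rw [Matrix.conjTranspose_eq_transpose_of_trivial, eS]
    simp only [Matrix.mul_neg, Matrix.neg_mul, Matrix.mul_add, Matrix.add_mul, Matrix.mul_assoc,
      hSU, Matrix.mul_one]
    simp only [← Matrix.mul_assoc, hUS, Matrix.one_mul]
  have hQ2 : (-(Nᵀ * V + V * N)).PosDef := by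
    have := hN.conjTranspose_mul_mul_same (B := V) (hinj hTV)
    convert this using 1
    rw [Matrix.conjTranspose_eq_transpose_of_trivial, eT]
    simp only [Matrix.mul_neg, Matrix.neg_mul, Matrix.mul_add, Matrix.add_mul, Matrix.mul_assoc,
      hTV, Matrix.mul_one]
    simp only [← Matrix.mul_assoc, hVT, Matrix.one_mul]
    rw [add_comm]
  -- Pair the equation with `U D V` in the trace inner product. Symmetrizing turns it into a
  -- vanishing sum of two traces of products of positive semidefinite matrices, so each trace
  -- vanishes.
  have e0 : (Dᵀ * (U * (M * D + D * Nᵀ) * V)).trace = 0 := by simp [h]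
  have e1 : (Dᵀ * (U * M) * D * V).trace + (Dᵀ * U * D * (Nᵀ * V)).trace = 0 := by
    rw [← Matrix.trace_add, ← e0]
    congr 1
    noncomm_ring
  have e2 : (Dᵀ * (Mᵀ * U) * D * V).trace = (Dᵀ * (U * M) * D * V).trace := by
    rw [← Matrix.trace_transpose]
    simp only [Matrix.transpose_mul, Matrix.transpose_transpose, eS, eT]
    rw [Matrix.trace_mul_comm]
    congr 1
    noncomm_ring
  have e3 : (Dᵀ * U * D * (V * N)).trace = (Dᵀ * U * D * (Nᵀ * V)).trace := by
    rw [← Matrix.trace_transpose]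
    simp only [Matrix.transpose_mul, Matrix.transpose_transpose, eS, eT]
    rw [Matrix.trace_mul_comm]
    congr 1
    noncomm_ring
  have e4 : ((Dᵀ * (-(U * M + Mᵀ * U)) * D) * V).trace
      + ((Dᵀ * U * D) * (-(Nᵀ * V + V * N))).trace = 0 := by
    have a1 : (Dᵀ * (-(U * M + Mᵀ * U)) * D) * V
        = -(Dᵀ * (U * M) * D * V + Dᵀ * (Mᵀ * U) * D * V) := by noncomm_ring
    have a2 : (Dᵀ * U * D) * (-(Nᵀ * V + V * N))
        = -(Dᵀ * U * D * (Nᵀ * V) + Dᵀ * U * D * (V * N)) := by noncomm_ring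
    rw [a1, a2, Matrix.trace_neg, Matrix.trace_neg, Matrix.trace_add, Matrix.trace_add]
    linarith
  have n1 := (hQ1.posSemidef.transpose_mul_mul D).trace_mul_nonneg hT'.posSemidef
  have n2 := (hS'.posSemidef.transpose_mul_mul D).trace_mul_nonneg hQ2.posSemidef
  have z1 : ((Dᵀ * (-(U * M + Mᵀ * U)) * D) * V).trace = 0 := by linarith
  have z2 : ((D * Kᵀ)ᵀ * (-(U * M + Mᵀ * U)) * (D * Kᵀ)).trace = 0 := by
    rw [← z1, hK, ← Matrix.mul_assoc _ Kᵀ K, Matrix.trace_mul_comm _ K]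
    congr 1
    simp only [Matrix.transpose_mul, Matrix.transpose_transpose, Matrix.mul_assoc]
  have z3 := hQ1.eq_zero_of_transpose_mul_mul
    ((hQ1.posSemidef.transpose_mul_mul _).trace_eq_zero_iff.1 z2)
  calc D = D * (V * T) := by rw [hVT, Matrix.mul_one]
    _ = (D * Kᵀ) * K * T := by rw [hK]; simp only [Matrix.mul_assoc]
    _ = 0 := by rw [z3]; simp

/-- The closed-loop matrix of a positive definite Riccati solution has a Lyapunov function. -/
theorem riccati_closedLoop_lyapunov {A C P S : Matrix ι ι ℝ} (hC : C.PosSemidef) (hP : P.PosDef)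
    (hS : S.PosDef) (h : A * S + S * Aᵀ - S * C * S + P = 0) :
    (-((A - S * C) * S + S * (A - S * C)ᵀ)).PosDef := by
  have eS : Sᵀ = S := by simpa using hS.isHermitian.eq
  have eC : Cᵀ = C := by simpa using hC.isHermitian.eq
  have := hP.add_posSemidef (hC.transpose_mul_mul S)
  convert this using 1
  rw [Matrix.transpose_sub, Matrix.transpose_mul, eS, eC]
  have e : P = P - (A * S + S * Aᵀ - S * C * S + P) := by rw [h, sub_zero]
  rw [e]
  noncomm_ring

/-- Subtracting the two equations gives `(A - S C) D + D (A - T C)ᵀ = 0` for `D = S - T`: the mixed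
terms `S C T` cancel. -/
theorem riccati_unique [DecidableEq ι] {A C P S T : Matrix ι ι ℝ} (hC : C.PosSemidef)
    (hP : P.PosDef) (hS : S.PosDef) (hT : T.PosDef) (h : A * S + S * Aᵀ - S * C * S + P = 0)
    (h' : A * T + T * Aᵀ - T * C * T + P = 0) : S = T := by
  have eT : Tᵀ = T := by simpa using hT.isHermitian.eq
  have eC : Cᵀ = C := by simpa using hC.isHermitian.eq
  refine sub_eq_zero.1 (sylvester_eq_zero hS hT (riccati_closedLoop_lyapunov hC hP hS h)
    (riccati_closedLoop_lyapunov hC hP hT h') ?_)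
  rw [Matrix.transpose_sub, Matrix.transpose_mul, eT, eC]
  calc _ = (A * S + S * Aᵀ - S * C * S + P) - (A * T + T * Aᵀ - T * C * T + P) := by noncomm_ring
    _ = 0 := by rw [h, h', sub_zero]

/-- The quadratic form is positive on the compact unit sphere, which persists under perturbation.
Symmetry is a separate condition because the neighbourhood lies in the space of all matrices. -/
theorem Matrix.PosDef.eventually_posDef {S : Matrix ι ι ℝ} (hS : S.PosDef) :
    ∀ᶠ T in 𝓝 S, Tᵀ = T → T.PosDef := by
  have key : ∀ᶠ T in 𝓝 S, ∀ v ∈ Metric.sphere (0 : ι → ℝ) 1, 0 < v ⬝ᵥ (T *ᵥ v) := by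
    refine (isCompact_sphere _ _).eventually_forall_of_forall_eventually fun v hv => ?_
    have hc : Continuous fun z : Matrix ι ι ℝ × (ι → ℝ) => z.2 ⬝ᵥ (z.1 *ᵥ z.2) := by fun_prop
    refine hc.continuousAt.eventually_mem (Ioi_mem_nhds ?_)
    simpa using hS.dotProduct_mulVec_pos (x := v) (by rintro rfl; simp at hv)
  filter_upwards [key] with T hT hsym
  refine PosDef.of_dotProduct_mulVec_pos (by simpa [IsHermitian] using hsym) fun v hv => ?_
  have hn : 0 < ‖v‖ := norm_pos_iff.2 hv
  have h1 := hT (‖v‖⁻¹ • v) (by simp [norm_smul, hn.ne'])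
  rw [Matrix.mulVec_smul, dotProduct_smul, smul_dotProduct, smul_smul, smul_eq_mul] at h1
  simpa using pos_of_mul_pos_right h1 (by positivity)

attribute [local instance] Matrix.linftyOpNormedRing Matrix.linftyOpNormedAlgebra

/-- Near a positive definite Riccati solution, the equation with nearby symmetric data has
positive definite solutions close to the given one. -/
theorem riccati_eventually_exists [DecidableEq ι] {A C P S : Matrix ι ι ℝ} (hC : C.PosSemidef)
    (hP : P.PosDef) (hS : S.PosDef) (h : A * S + S * Aᵀ - S * C * S + P = 0)
    {U : Set (Matrix ι ι ℝ)} (hU : U ∈ 𝓝 S) :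
    ∀ᶠ x : Matrix ι ι ℝ × Matrix ι ι ℝ × Matrix ι ι ℝ in 𝓝 (A, C, P),
      x.2.1ᵀ = x.2.1 → x.2.2ᵀ = x.2.2 → ∃ T ∈ U, T.PosDef ∧
        x.1 * T + T * x.1ᵀ - T * x.2.1 * T + x.2.2 = 0 := by
  have eS : Sᵀ = S := by simpa using hS.isHermitian.eq
  have eC : Cᵀ = C := by simpa using hC.isHermitian.eq
  let E := Matrix ι ι ℝ × Matrix ι ι ℝ × Matrix ι ι ℝ
  -- The Riccati equation gives `P` explicitly in terms of `(A, C, S)`. Carrying `A` and `C` along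
  -- makes `G` an endomap of a finite-dimensional space, so an injective derivative is invertible.
  let G : E → E := fun x => (x.1, x.2.1, x.2.2 * x.2.1 * x.2.2 - x.1 * x.2.2 - x.2.2 * x.1ᵀ)
  let τ : Matrix ι ι ℝ →L[ℝ] Matrix ι ι ℝ :=
    { toFun := Matrix.transpose
      map_add' := Matrix.transpose_add
      map_smul' := Matrix.transpose_smul
      cont := continuous_id.matrix_transpose }
  let p1 : E →L[ℝ] Matrix ι ι ℝ :=
    ContinuousLinearMap.fst ℝ (Matrix ι ι ℝ) (Matrix ι ι ℝ × Matrix ι ι ℝ)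
  let q : E →L[ℝ] Matrix ι ι ℝ × Matrix ι ι ℝ :=
    ContinuousLinearMap.snd ℝ (Matrix ι ι ℝ) (Matrix ι ι ℝ × Matrix ι ι ℝ)
  let p2 : E →L[ℝ] Matrix ι ι ℝ :=
    (ContinuousLinearMap.fst ℝ (Matrix ι ι ℝ) (Matrix ι ι ℝ)).comp q
  let p3 : E →L[ℝ] Matrix ι ι ℝ :=
    (ContinuousLinearMap.snd ℝ (Matrix ι ι ℝ) (Matrix ι ι ℝ)).comp q
  have d1 : HasStrictFDerivAt (fun x : E => x.1) p1 (A, C, S) := p1.hasStrictFDerivAt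
  have d2 : HasStrictFDerivAt (fun x : E => x.2.1) p2 (A, C, S) := p2.hasStrictFDerivAt
  have d3 : HasStrictFDerivAt (fun x : E => x.2.2) p3 (A, C, S) := p3.hasStrictFDerivAt
  have d4 : HasStrictFDerivAt (fun x : E => x.1ᵀ) (τ.comp p1) (A, C, S) :=
    (τ.comp p1).hasStrictFDerivAt
  obtain ⟨G', dG, hval⟩ : ∃ G' : E →L[ℝ] E, HasStrictFDerivAt G G' (A, C, S) ∧
      ∀ a b d, G' (a, b, d) = (a, b, (S * C * d + (S * b + d * C) * S) - (A * d + a * S)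
        - (S * aᵀ + d * Aᵀ)) :=
    ⟨_, d1.prodMk (d2.prodMk ((((d3.mul' d2).mul' d3).sub (d1.mul' d3)).sub (d3.mul' d4))),
      fun _ _ _ => rfl⟩
  have hinj : Function.Injective G' := by
    rw [injective_iff_map_eq_zero]
    rintro ⟨a, b, d⟩ hz
    rw [hval, Prod.mk_eq_zero, Prod.mk_eq_zero] at hz
    obtain ⟨rfl, rfl, hd⟩ := hz
    have : d = 0 := by
      have hl := riccati_closedLoop_lyapunov hC hP hS h
      refine sylvester_eq_zero hS hS hl hl ?_
      rw [Matrix.transpose_sub, Matrix.transpose_mul, eS, eC]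
      rw [Matrix.transpose_zero] at hd
      rw [← neg_eq_zero, ← hd]
      noncomm_ring
    rw [this]; rfl
  let e : E ≃L[ℝ] E :=
    (LinearEquiv.ofInjectiveEndo (G' : E →ₗ[ℝ] E) hinj).toContinuousLinearEquiv
  have he : (e : E →L[ℝ] E) = G' := ContinuousLinearMap.ext fun _ => rfl
  rw [← he] at dG
  let φ := dG.toOpenPartialHomeomorph
  have hφ : φ.source ∈ 𝓝 (A, C, S) :=
    φ.open_source.mem_nhds dG.mem_toOpenPartialHomeomorph_source
  -- The inverse function theorem may return a nonsymmetric `T`. Keeping `Tᵀ` in the domain of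
  -- injectivity too forces `T = Tᵀ`, since both solve the equation with the same symmetric data.
  have hφ' : {x : E | (x.1, x.2.1, x.2.2ᵀ) ∈ φ.source} ∈ 𝓝 (A, C, S) := by
    have hc : Continuous fun x : E => ((x.1, x.2.1, x.2.2ᵀ) : E) := by fun_prop
    refine hc.continuousAt.preimage_mem_nhds ?_
    simpa [eS] using hφ
  have hS2 : Tendsto (fun x : E => x.2.2) (𝓝 (A, C, S)) (𝓝 S) := p3.continuous.continuousAt
  have hN := inter_mem hφ (inter_mem hφ'
    (inter_mem (hS2 hU) (hS2.eventually hS.eventually_posDef)))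
  have hP' : G (A, C, S) = (A, C, P) := by
    have : S * C * S - A * S - S * Aᵀ = P := by
      rw [← sub_eq_zero, ← neg_eq_zero, ← h]; abel
    simp only [G, this]
  have him := dG.map_nhds_eq_of_equiv.ge (image_mem_map hN)
  rw [hP'] at him
  filter_upwards [him]
  rintro _ ⟨⟨A', C', T⟩, ⟨hs, hs', hTU, hpos⟩, rfl⟩ hCs hPs
  simp only [G] at hCs hPs ⊢
  have hsym : Tᵀ = T := by
    have : G (A', C', Tᵀ) = G (A', C', T) := by
      simp only [G]
      rw [← hPs]
      simp only [Matrix.transpose_sub, Matrix.transpose_mul, Matrix.transpose_transpose, hCs]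
      noncomm_ring
    exact congrArg (fun x : E => x.2.2) (φ.injOn hs' hs this)
  refine ⟨T, hTU, hpos hsym, ?_⟩
  abel

end RiccatiLemmas

/-! ### Existence of Riccati solutions for observable pairs -/

section RiccatiExistence

/-- The Gram determinant makes full rank the nonvanishing of one polynomial in the entries, suited
to both openness and analyticity arguments. -/
theorem Matrix.rank_eq_iff_det_mul_transpose_ne_zero {n : ℕ} {κ : Type*} [Fintype κ]
    (K : Matrix (Fin n) κ ℝ) : K.rank = n ↔ (K * Kᵀ).det ≠ 0 := by
  rw [← Matrix.rank_self_mul_transpose K, ← isUnit_iff_ne_zero, ← Matrix.isUnit_iff_isUnit_det]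
  constructor
  · intro h
    rw [← Matrix.linearIndependent_rows_iff_isUnit, linearIndependent_iff_card_eq_finrank_span]
    rw [Matrix.rank_eq_finrank_span_row] at h
    simpa [Set.finrank] using h.symm
  · intro h
    simpa using Matrix.rank_of_isUnit _ h

theorem isControllablePair_iff_det {n m : ℕ} (A : Matrix (Fin n) (Fin n) ℝ)
    (B : Matrix (Fin n) (Fin m) ℝ) : IsControllablePair A B ↔
      (controllabilityMatrix A B * (controllabilityMatrix A B)ᵀ).det ≠ 0 :=
  Matrix.rank_eq_iff_det_mul_transpose_ne_zero _

theorem isControllablePair_transpose_iff {n p : ℕ} (A : Matrix (Fin n) (Fin n) ℝ)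
    (c : Matrix (Fin n) (Fin p) ℝ) : IsControllablePair Aᵀ c ↔ IsObservablePair A c := by
  have : controllabilityMatrix Aᵀ c = (observabilityMatrix A c)ᵀ := by
    ext i q
    have h : Aᵀ ^ (q.1 : ℕ) * c = (cᵀ * A ^ (q.1 : ℕ))ᵀ := by
      rw [Matrix.transpose_mul, Matrix.transpose_pow, Matrix.transpose_transpose]
    exact congrFun (congrFun h i) q.2
  rw [IsControllablePair, IsObservablePair, this, Matrix.rank_transpose]

theorem IsObservablePair.eq_zero {n p : ℕ} {κ : Type*} {A : Matrix (Fin n) (Fin n) ℝ}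
    {c : Matrix (Fin n) (Fin p) ℝ} (h : IsObservablePair A c) {Z : Matrix (Fin n) κ ℝ}
    (hZ : ∀ k : ℕ, cᵀ * A ^ k * Z = 0) : Z = 0 := by
  have hO : observabilityMatrix A c * Z = 0 := by
    ext q j
    exact congrFun (congrFun (hZ q.1) q.2) j
  have hdet := (Matrix.rank_eq_iff_det_mul_transpose_ne_zero (observabilityMatrix A c)ᵀ).1
    (by rw [Matrix.rank_transpose]; exact h)
  rw [Matrix.transpose_transpose] at hdet
  rw [← Matrix.nonsing_inv_mul_cancel_left _ Z (isUnit_iff_ne_zero.2 hdet),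
    Matrix.mul_assoc _ _ Z, hO, Matrix.mul_zero, Matrix.mul_zero]

/-- The kernel of `Z` contains the columns of `c`. It is `Aᵀ`-invariant: for `Z v = 0` the
semidefinite form vanishes at `v`, hence kills `v`, leaving `Z Aᵀ v = 0`; the shift by `s` drops
out. Observability then gives `Z = 0`. This excludes blow-up in the continuity method. -/
theorem IsObservablePair.posSemidef_eq_zero {n p : ℕ} {A Z : Matrix (Fin n) (Fin n) ℝ}
    {c : Matrix (Fin n) (Fin p) ℝ} (h : IsObservablePair A c) (s : ℝ) (hZ : Z.PosSemidef)
    (hc : Z * (c * cᵀ) * Z = 0)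
    (hW : ((A - s • 1) * Z + Z * (A - s • 1)ᵀ).PosSemidef) : Z = 0 := by
  have eZ : Zᵀ = Z := by simpa using hZ.isHermitian.eq
  have hcZ : cᵀ * Z = 0 := by
    rw [← Matrix.conjTranspose_mul_self_eq_zero, Matrix.conjTranspose_eq_transpose_of_trivial,
      Matrix.transpose_mul, Matrix.transpose_transpose, eZ, ← hc]
    simp only [Matrix.mul_assoc]
  have hinv : ∀ V : Matrix (Fin n) (Fin p) ℝ, Z * V = 0 → Z * (Aᵀ * V) = 0 := by
    intro V hV
    have hV' : Vᵀ * Z = 0 := by rw [← eZ, ← Matrix.transpose_mul, hV, Matrix.transpose_zero]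
    have h1 := hW.mul_eq_zero_of_transpose_mul_mul (V := V) (by
      rw [Matrix.mul_add, Matrix.add_mul, ← Matrix.mul_assoc _ Z, hV', Matrix.mul_assoc,
        Matrix.mul_assoc, hV]
      simp)
    rw [Matrix.add_mul, Matrix.mul_assoc, hV, Matrix.mul_zero, zero_add, Matrix.transpose_sub,
      Matrix.transpose_smul, Matrix.transpose_one, Matrix.mul_sub, Matrix.sub_mul,
      Matrix.mul_smul, Matrix.mul_one, Matrix.smul_mul, hV, smul_zero, sub_zero] at h1
    rw [← Matrix.mul_assoc, h1]
  refine h.eq_zero fun k => ?_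
  have hk : Z * (Aᵀ ^ k * c) = 0 := by
    induction k with
    | zero =>
      rw [pow_zero, Matrix.one_mul, ← eZ, ← Matrix.transpose_transpose c, ← Matrix.transpose_mul,
        hcZ, Matrix.transpose_zero]
    | succ k ih => rw [pow_succ', Matrix.mul_assoc]; exact hinv _ ih
  have := congrArg Matrix.transpose hk
  simpa [Matrix.transpose_mul, Matrix.transpose_pow, eZ] using this

theorem Matrix.isClosed_posSemidef {ι : Type*} [Fintype ι] :
    IsClosed {M : Matrix ι ι ℝ | M.PosSemidef} := by
  have : {M : Matrix ι ι ℝ | M.PosSemidef}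
      = {M | Mᵀ = M} ∩ ⋂ v : ι → ℝ, {M | 0 ≤ v ⬝ᵥ (M *ᵥ v)} := by
    ext M
    simp [Matrix.posSemidef_iff_dotProduct_mulVec, Matrix.IsHermitian]
  rw [this]
  refine (isClosed_eq (by fun_prop) (by fun_prop)).inter (isClosed_iInter fun v => ?_)
  exact isClosed_le continuous_const (by fun_prop)

/-- For small `ε > 0` the matrix `1 + ε H` is positive definite; divide by `ε`. -/
theorem Matrix.IsHermitian.exists_add_smul_one_posDef {ι : Type*} [Fintype ι] [DecidableEq ι]
    {H : Matrix ι ι ℝ} (hH : Hᵀ = H) : ∃ s : ℝ, (H + s • 1).PosDef := by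
  have hc : Tendsto (fun ε : ℝ => (1 : Matrix ι ι ℝ) + ε • H) (𝓝[>] 0) (𝓝 1) := by
    have : Continuous fun ε : ℝ => (1 : Matrix ι ι ℝ) + ε • H := by fun_prop
    simpa using (this.tendsto 0).mono_left nhdsWithin_le_nhds
  obtain ⟨ε, h1, h2⟩ := ((hc.eventually (PosDef.one (n := ι) (R := ℝ)).eventually_posDef).and
    self_mem_nhdsWithin).exists
  have hε : 0 < ε := h2
  refine ⟨ε⁻¹, ?_⟩
  have := (h1 (by simp [hH])).smul (inv_pos.2 hε)
  convert this using 1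
  rw [smul_add, smul_smul, inv_mul_cancel₀ hε.ne', one_smul, add_comm]

/-- If `S v = 0`, compressing the equation to `v` leaves only `vᵀ P v = 0`. -/
theorem riccati_posDef_of_posSemidef {ι : Type*} [Fintype ι] [DecidableEq ι]
    {A C P S : Matrix ι ι ℝ} (hP : P.PosDef) (hS : S.PosSemidef)
    (h : A * S + S * Aᵀ - S * C * S + P = 0) : S.PosDef := by
  have eS : Sᵀ = S := by simpa using hS.isHermitian.eq
  rw [hS.posDef_iff_det_ne_zero]
  intro hdet
  obtain ⟨v, hv, hSv⟩ := Matrix.exists_mulVec_eq_zero_iff.2 hdet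
  have hV : S * replicateCol (Fin 1) v = 0 := by
    rw [← Matrix.replicateCol_mulVec, hSv, Matrix.replicateCol_zero]
  have hV' : (replicateCol (Fin 1) v)ᵀ * S = 0 := by
    rw [← eS, ← Matrix.transpose_mul, hV, Matrix.transpose_zero]
  generalize hVdef : replicateCol (Fin 1) v = V at hV hV'
  have hz : Vᵀ * P * V = 0 := by
    calc Vᵀ * P * V = Vᵀ * (A * S + S * Aᵀ - S * C * S + P) * V
          - (Vᵀ * A * (S * V) + (Vᵀ * S) * Aᵀ * V - (Vᵀ * S) * C * S * V) := by
          simp only [Matrix.mul_add, Matrix.add_mul, Matrix.mul_sub, Matrix.sub_mul,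
            Matrix.mul_assoc]
          abel
      _ = 0 := by rw [h, hV, hV']; simp
  have := hP.eq_zero_of_transpose_mul_mul hz
  apply hv
  ext i
  simpa [← hVdef] using congrFun (congrFun this i) 0

section Limit

attribute [local instance] Matrix.linftyOpNormedRing Matrix.linftyOpNormedAlgebra

/-- Positive definite Riccati solutions survive limits of the data, as long as the limiting
data exclude a nonzero asymptotic direction of blow-up. -/
theorem riccati_exists_of_tendsto {ι : Type*} [Fintype ι] [DecidableEq ι]
    {a q S : ℕ → Matrix ι ι ℝ} {A C P : Matrix ι ι ℝ} (hC : C.PosSemidef) (hP : P.PosDef)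
    (ha : Tendsto a atTop (𝓝 A)) (hq : Tendsto q atTop (𝓝 P)) (hS : ∀ k, (S k).PosDef)
    (h : ∀ k, a k * S k + S k * (a k)ᵀ - S k * C * S k + q k = 0)
    (hZ : ∀ Z : Matrix ι ι ℝ, Z.PosSemidef → Z * C * Z = 0 → (A * Z + Z * Aᵀ).PosSemidef → Z = 0) :
    ∃ T : Matrix ι ι ℝ, T.PosDef ∧ A * T + T * Aᵀ - T * C * T + P = 0 := by
  have haT : Tendsto (fun k => (a k)ᵀ) atTop (𝓝 Aᵀ) :=
    (continuous_id.matrix_transpose.tendsto A).comp ha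
  by_cases hb : ∃ R : ℝ, ∃ᶠ k in atTop, ‖S k‖ ≤ R
  · obtain ⟨R, hR⟩ := hb
    obtain ⟨T, -, φ, hφ, hT⟩ := tendsto_subseq_of_frequently_bounded
      (Metric.isBounded_closedBall (x := (0 : Matrix ι ι ℝ)) (r := R)) (by simpa using hR)
    have hT0 : T.PosSemidef :=
      Matrix.isClosed_posSemidef.mem_of_tendsto hT (.of_forall fun k => (hS _).posSemidef)
    have hat := ha.comp hφ.tendsto_atTop
    have hlim := (((hat.mul hT).add (hT.mul (haT.comp hφ.tendsto_atTop))).sub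
      ((hT.mul_const C).mul hT)).add (hq.comp hφ.tendsto_atTop)
    have heq : A * T + T * Aᵀ - T * C * T + P = 0 :=
      tendsto_nhds_unique hlim (tendsto_const_nhds.congr fun k => (h (φ k)).symm)
    exact ⟨T, riccati_posDef_of_posSemidef hP hT0 heq, heq⟩
  -- Normalize to `S / ‖S‖` and extract a limit `Z` of norm one. Dividing the equation by `‖S‖`
  -- shows that `A Z + Z Aᵀ` is a limit of semidefinite matrices; dividing once more gives `Z C Z =
  -- 0`. So `hZ` applies.
  · exfalso
    have hn : Tendsto (fun k => ‖S k‖) atTop atTop := by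
      refine tendsto_atTop.2 fun R => ?_
      have : ¬ ∃ᶠ k in atTop, ‖S k‖ ≤ R := fun hR => hb ⟨R, hR⟩
      rw [not_frequently] at this
      filter_upwards [this] with k hk using (not_le.1 hk).le
    have hpos : ∀ᶠ k in atTop, 0 < ‖S k‖ := hn.eventually_gt_atTop 0
    obtain ⟨Z, -, φ, hφ, hZlim⟩ := tendsto_subseq_of_frequently_bounded
      (x := fun k => ‖S k‖⁻¹ • S k)
      (Metric.isBounded_sphere (x := (0 : Matrix ι ι ℝ)) (r := 1)) (by
        refine (hpos.mono fun k hk => ?_).frequently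
        simp [norm_smul, hk.ne'])
    have hpos' := hφ.tendsto_atTop.eventually hpos
    have hinv : Tendsto (fun k => ‖S (φ k)‖⁻¹) atTop (𝓝 0) :=
      (tendsto_inv_atTop_zero.comp hn).comp hφ.tendsto_atTop
    have hnorm : ‖Z‖ = 1 := by
      refine tendsto_nhds_unique hZlim.norm (tendsto_const_nhds.congr' ?_)
      filter_upwards [hpos'] with k hk
      simp [norm_smul, hk.ne']
    have hZ0 : Z.PosSemidef :=
      Matrix.isClosed_posSemidef.mem_of_tendsto hZlim
        (.of_forall fun k => (hS _).posSemidef.smul (by positivity))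
    have hA := (((ha.comp hφ.tendsto_atTop).mul hZlim).add
      (hZlim.mul (haT.comp hφ.tendsto_atTop))).add (hinv.smul (hq.comp hφ.tendsto_atTop))
    rw [zero_smul, add_zero] at hA
    have hrel : ∀ k, a (φ k) * (‖S (φ k)‖⁻¹ • S (φ k)) + (‖S (φ k)‖⁻¹ • S (φ k)) * (a (φ k))ᵀ
        + ‖S (φ k)‖⁻¹ • q (φ k) = ‖S (φ k)‖⁻¹ • (S (φ k) * C * S (φ k)) := by
      intro k
      rw [Matrix.mul_smul, Matrix.smul_mul, ← smul_add, ← smul_add]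
      congr 1
      rw [← sub_eq_zero, ← h (φ k)]
      abel
    have hW : (A * Z + Z * Aᵀ).PosSemidef := by
      refine Matrix.isClosed_posSemidef.mem_of_tendsto hA (.of_forall fun k => ?_)
      change (a (φ k) * (‖S (φ k)‖⁻¹ • S (φ k)) + (‖S (φ k)‖⁻¹ • S (φ k)) * (a (φ k))ᵀ
        + ‖S (φ k)‖⁻¹ • q (φ k)).PosSemidef
      rw [hrel]
      have eS : (S (φ k))ᵀ = S (φ k) := by simpa using (hS (φ k)).isHermitian.eq
      have := hC.transpose_mul_mul (S (φ k))
      rw [eS] at this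
      exact this.smul (by positivity)
    have hZCZ : Z * C * Z = 0 := by
      have h0 := hinv.smul hA
      rw [zero_smul] at h0
      refine tendsto_nhds_unique ((hZlim.mul_const C).mul hZlim) (h0.congr fun k => ?_)
      change ‖S (φ k)‖⁻¹ • (a (φ k) * (‖S (φ k)‖⁻¹ • S (φ k))
        + (‖S (φ k)‖⁻¹ • S (φ k)) * (a (φ k))ᵀ + ‖S (φ k)‖⁻¹ • q (φ k))
        = (‖S (φ k)‖⁻¹ • S (φ k)) * C * (‖S (φ k)‖⁻¹ • S (φ k))
      rw [hrel]
      simp only [Matrix.mul_smul, Matrix.smul_mul]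
    rw [hZ Z hZ0 hZCZ hW, norm_zero] at hnorm
    exact zero_ne_one hnorm

end Limit

theorem Matrix.PosDef.segment {ι : Type*} [Finite ι] {P Q : Matrix ι ι ℝ} (hP : P.PosDef)
    (hQ : Q.PosDef) {t : ℝ} (h0 : 0 ≤ t) (h1 : t ≤ 1) : ((1 - t) • P + t • Q).PosDef := by
  rcases h0.eq_or_lt with rfl | h0
  · simpa using hP
  · exact (hQ.smul h0).posSemidef_add (hP.posSemidef.smul (sub_nonneg.2 h1))

theorem posSemidef_self_mul_transpose {ι κ : Type*} [Fintype κ] [Finite ι] (c : Matrix ι κ ℝ) :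
    (c * cᵀ).PosSemidef := by
  simpa using Matrix.posSemidef_self_mul_conjTranspose c

/-- The Riccati equation of an observable pair has a positive definite solution. -/
theorem IsObservablePair.exists_riccati {n p : ℕ} {A P : Matrix (Fin n) (Fin n) ℝ}
    {c : Matrix (Fin n) (Fin p) ℝ} (hobs : IsObservablePair A c) (hP : P.PosDef) :
    ∃ S : Matrix (Fin n) (Fin n) ℝ, S.PosDef ∧ A * S + S * Aᵀ - S * (c * cᵀ) * S + P = 0 := by
  set C := c * cᵀ with hCdef
  have hC : C.PosSemidef := posSemidef_self_mul_transpose c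
  have eC : Cᵀ = C := by simpa using hC.isHermitian.eq
  -- The homotopy starts at drift `A - s / 2`, where the identity solves the equation with constant
  -- term `C - A - Aᵀ + s`; `s` is chosen to make that term positive definite.
  obtain ⟨s, hs⟩ := Matrix.IsHermitian.exists_add_smul_one_posDef (H := C - A - Aᵀ) (by
    simp only [Matrix.transpose_sub, Matrix.transpose_transpose, eC]; abel)
  let a : unitInterval → Matrix (Fin n) (Fin n) ℝ := fun t => A - ((1 - (t : ℝ)) * (s / 2)) • 1
  let q : unitInterval → Matrix (Fin n) (Fin n) ℝ :=
    fun t => (1 - (t : ℝ)) • (C - A - Aᵀ + s • 1) + (t : ℝ) • P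
  have hca : Continuous a := by fun_prop
  have hcq : Continuous q := by fun_prop
  have hq : ∀ t, (q t).PosDef := fun t => hs.segment hP t.2.1 t.2.2
  let 𝒯 : Set unitInterval :=
    {t | ∃ S : Matrix (Fin n) (Fin n) ℝ, S.PosDef ∧ a t * S + S * (a t)ᵀ - S * C * S + q t = 0}
  have hopen : IsOpen 𝒯 := by
    refine isOpen_iff_mem_nhds.2 ?_
    rintro t ⟨S, hS, hSeq⟩
    have hc : Continuous fun t => (a t, C, q t) := by fun_prop
    filter_upwards [hc.continuousAt.eventually
      (riccati_eventually_exists hC (hq t) hS hSeq univ_mem)] with t' ht'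
    obtain ⟨T, -, hT, hTeq⟩ := ht' eC (by simpa using (hq t').isHermitian.eq)
    exact ⟨T, hT, hTeq⟩
  have hclosed : IsClosed 𝒯 := by
    refine IsSeqClosed.isClosed fun u t hu hut => ?_
    choose S hS hSeq using hu
    exact riccati_exists_of_tendsto hC (hq t) ((hca.tendsto t).comp hut)
      ((hcq.tendsto t).comp hut) hS hSeq fun Z hZ hZC hW => hobs.posSemidef_eq_zero _ hZ hZC hW
  have hzero : (0 : unitInterval) ∈ 𝒯 := by
    refine ⟨1, PosDef.one, ?_⟩
    have e : s • (1 : Matrix (Fin n) (Fin n) ℝ) = (s / 2) • 1 + (s / 2) • 1 := by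
      rw [← add_smul, add_halves]
    simp only [a, q, Set.Icc.coe_zero, sub_zero, one_mul, one_smul, zero_smul, mul_one, e,
      Matrix.transpose_sub, Matrix.transpose_smul, Matrix.transpose_one]
    abel
  have huniv := IsClopen.eq_univ ⟨hclosed, hopen⟩ ⟨0, hzero⟩
  obtain ⟨S, hS, hSeq⟩ : (1 : unitInterval) ∈ 𝒯 := huniv ▸ Set.mem_univ _
  exact ⟨S, hS, by simpa [a, q] using hSeq⟩

end RiccatiExistence

/-! ### Regular triplets: controllability along analytic curves, openness and density -/

section RegularTriplets

theorem isPosDefRiccatiSolution_iff {n p : ℕ} {A P S : Matrix (Fin n) (Fin n) ℝ}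
    {c : Matrix (Fin n) (Fin p) ℝ} {r : ℝ} : IsPosDefRiccatiSolution A c P r S ↔
      S.PosDef ∧ A * S + S * Aᵀ - S * (r • (c * cᵀ)) * S + P = 0 := by
  rw [IsPosDefRiccatiSolution, Matrix.mul_smul, Matrix.smul_mul, ← Matrix.mul_assoc S c]

theorem mem_regularTriplets_iff {n p : ℕ}
    {x : Matrix (Fin n) (Fin n) ℝ × Matrix (Fin n) (Fin p) ℝ × Matrix (Fin n) (Fin n) ℝ} :
    x ∈ regularTriplets n p ↔ x ∈ observableTriplets n p ∧ ∃ r : ℝ, 0 < r ∧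
      ∃ S : Matrix (Fin n) (Fin n) ℝ, S.PosDef ∧
        x.1 * S + S * x.1ᵀ - S * (r • (x.2.1 * x.2.1ᵀ)) * S + x.2.2 = 0 ∧
        IsControllablePair x.1 (S * x.2.1) := by
  refine and_congr_right fun hx => exists_congr fun r => and_congr_right fun hr =>
    exists_congr fun S => ?_
  constructor
  · rintro ⟨h, -, hc⟩
    obtain ⟨h1, h2⟩ := isPosDefRiccatiSolution_iff.1 h
    exact ⟨h1, h2, hc⟩
  · rintro ⟨h1, h2, hc⟩
    refine ⟨isPosDefRiccatiSolution_iff.2 ⟨h1, h2⟩, fun T hT => ?_, hc⟩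
    obtain ⟨h1', h2'⟩ := isPosDefRiccatiSolution_iff.1 hT
    exact riccati_unique ((posSemidef_self_mul_transpose _).smul hr.le) hx.2 h1' h1 h2' h2

theorem continuous_controllabilityMatrix {n m : ℕ} :
    Continuous fun x : Matrix (Fin n) (Fin n) ℝ × Matrix (Fin n) (Fin m) ℝ =>
      controllabilityMatrix x.1 x.2 := by
  refine continuous_matrix fun i q => ?_
  have : Continuous fun x : Matrix (Fin n) (Fin n) ℝ × Matrix (Fin n) (Fin m) ℝ =>
      x.1 ^ (q.1 : ℕ) * x.2 := by fun_prop
  exact this.matrix_elem i q.2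

theorem isOpen_isControllablePair {n m : ℕ} :
    IsOpen {x : Matrix (Fin n) (Fin n) ℝ × Matrix (Fin n) (Fin m) ℝ |
      IsControllablePair x.1 x.2} := by
  simp only [isControllablePair_iff_det]
  have := continuous_controllabilityMatrix (n := n) (m := m)
  exact isOpen_ne_fun (by fun_prop) continuous_const

section Analytic

variable {ι κ μ : Type*}

theorem analyticOnNhd_matrix_mul [Fintype κ] {M : ℝ → Matrix ι κ ℝ} {N : ℝ → Matrix κ μ ℝ}
    {U : Set ℝ} (hM : ∀ i j, AnalyticOnNhd ℝ (fun t => M t i j) U)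
    (hN : ∀ i j, AnalyticOnNhd ℝ (fun t => N t i j) U) (i : ι) (j : μ) :
    AnalyticOnNhd ℝ (fun t => (M t * N t) i j) U := by
  simp only [Matrix.mul_apply]
  exact Finset.analyticOnNhd_fun_sum _ fun k _ => (hM i k).mul (hN k j)

theorem analyticOnNhd_matrix_pow [Fintype ι] [DecidableEq ι] {M : ℝ → Matrix ι ι ℝ} {U : Set ℝ}
    (hM : ∀ i j, AnalyticOnNhd ℝ (fun t => M t i j) U) (k : ℕ) :
    ∀ i j, AnalyticOnNhd ℝ (fun t => (M t ^ k) i j) U := by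
  induction k with
  | zero => intro i j; simpa using analyticOnNhd_const
  | succ k ih => intro i j; simpa only [pow_succ] using analyticOnNhd_matrix_mul ih hM i j

theorem analyticOnNhd_matrix_det [Fintype ι] [DecidableEq ι] {M : ℝ → Matrix ι ι ℝ} {U : Set ℝ}
    (hM : ∀ i j, AnalyticOnNhd ℝ (fun t => M t i j) U) :
    AnalyticOnNhd ℝ (fun t => (M t).det) U := by
  simp only [Matrix.det_apply']
  exact Finset.analyticOnNhd_fun_sum _ fun σ _ =>
    analyticOnNhd_const.mul (Finset.analyticOnNhd_fun_prod _ fun i _ => hM _ _)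

/-- Along an analytic curve of pairs, controllability at one parameter implies controllability
at all parameters close to and different from any given one. -/
theorem IsControllablePair.eventually_of_analytic {n m : ℕ} {A : ℝ → Matrix (Fin n) (Fin n) ℝ}
    {B : ℝ → Matrix (Fin n) (Fin m) ℝ}
    (hA : ∀ i j, AnalyticOnNhd ℝ (fun t => A t i j) Set.univ)
    (hB : ∀ i j, AnalyticOnNhd ℝ (fun t => B t i j) Set.univ) {t₁ : ℝ}
    (h : IsControllablePair (A t₁) (B t₁)) (t₀ : ℝ) :
    ∀ᶠ t in 𝓝[≠] t₀, IsControllablePair (A t) (B t) := by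
  simp only [isControllablePair_iff_det] at h ⊢
  have hK : ∀ i q, AnalyticOnNhd ℝ (fun t => controllabilityMatrix (A t) (B t) i q) Set.univ :=
    fun i q => analyticOnNhd_matrix_mul (analyticOnNhd_matrix_pow hA q.1) hB i q.2
  have hf := analyticOnNhd_matrix_det (analyticOnNhd_matrix_mul hK
    (N := fun t => (controllabilityMatrix (A t) (B t))ᵀ) fun i j => hK j i)
  by_contra hne
  -- Identity theorem: zeros of the Gram determinant accumulating at `t₀` would make it vanish at
  -- `t₁` as well.
  exact h (hf.eqOn_zero_of_preconnected_of_frequently_eq_zero isPreconnected_univ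
    (Set.mem_univ t₀) ((not_eventually.1 hne).mono fun _ ht => not_not.1 ht) (Set.mem_univ t₁))

end Analytic

theorem isOpen_regularTriplets (n p : ℕ) :
    IsOpen {x : observableTriplets n p | x.1 ∈ regularTriplets n p} := by
  refine isOpen_iff_mem_nhds.2 ?_
  rintro ⟨⟨A, c, P⟩, hx⟩ hreg
  obtain ⟨-, r, hr, S, hS, hSeq, hctrl⟩ := mem_regularTriplets_iff.1 hreg
  have hc : Continuous fun y : (Matrix (Fin n) (Fin n) ℝ × Matrix (Fin n) (Fin p) ℝ) ×
      Matrix (Fin n) (Fin n) ℝ => (y.1.1, y.2 * y.1.2) :=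
    continuous_fst.fst.prodMk (continuous_snd.matrix_mul continuous_fst.snd)
  have hmem := (isOpen_isControllablePair.preimage hc).mem_nhds
    (show ((A, c), S) ∈ _ ⁻¹' _ from hctrl)
  obtain ⟨V, hV, U, hU, hVU⟩ := mem_nhds_prod_iff.1 hmem
  have hg : Continuous fun x : Matrix (Fin n) (Fin n) ℝ × Matrix (Fin n) (Fin p) ℝ ×
      Matrix (Fin n) (Fin n) ℝ => (x.1, r • (x.2.1 * x.2.1ᵀ), x.2.2) := by fun_prop
  have hg' : Continuous fun x : Matrix (Fin n) (Fin n) ℝ × Matrix (Fin n) (Fin p) ℝ ×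
      Matrix (Fin n) (Fin n) ℝ => (x.1, x.2.1) := by fun_prop
  have h1 := (hg.tendsto (A, c, P)).eventually (riccati_eventually_exists
    ((posSemidef_self_mul_transpose c).smul hr.le) hx.2 hS hSeq hU)
  have h2 := (hg'.tendsto (A, c, P)).eventually_mem hV
  filter_upwards [continuous_subtype_val.continuousAt.eventually (h1.and h2)]
  rintro ⟨⟨A', c', P'⟩, hx'⟩ ⟨hT, hV'⟩
  obtain ⟨T, hTU, hTpos, hTeq⟩ := hT
    (by simp [Matrix.transpose_mul]) (by simpa using hx'.2.isHermitian.eq)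
  have hV'' : (A', c') ∈ V := hV'
  have hctrl' : IsControllablePair A' (T * c') :=
    Set.mem_preimage.1 (hVU (Set.mk_mem_prod hV'' hTU))
  have hreg' : (A', c', P') ∈ regularTriplets n p :=
    mem_regularTriplets_iff.2 ⟨hx', r, hr, T, hTpos, hTeq, hctrl'⟩
  exact hreg'

theorem dense_regularTriplets (n p : ℕ) :
    Dense {x : observableTriplets n p | x.1 ∈ regularTriplets n p} := by
  rw [Subtype.dense_iff]
  rintro ⟨A, c, P⟩ ⟨hobs, hP⟩
  obtain ⟨S, hS, hSeq⟩ := hobs.exists_riccati hP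
  have eS : Sᵀ = S := by simpa using hS.isHermitian.eq
  dsimp only at hobs hP
  -- The endpoint `(Aᵀ, 1)` is chosen so that `(a 1, σ 1 * c) = (Aᵀ, c)`. The term `q` is defined so
  -- that `σ t` solves the equation with `r = 1` for every `t`; positivity of `σ` and `q` is needed
  -- only near `t = 0`.
  let a : ℝ → Matrix (Fin n) (Fin n) ℝ := fun t => A + t • (Aᵀ - A)
  let σ : ℝ → Matrix (Fin n) (Fin n) ℝ := fun t => S + t • (1 - S)
  let q : ℝ → Matrix (Fin n) (Fin n) ℝ :=
    fun t => σ t * (c * cᵀ) * σ t - a t * σ t - σ t * (a t)ᵀ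
  have hca : Continuous a := by fun_prop
  have hcσ : Continuous σ := by fun_prop
  have hcq : Continuous q := by fun_prop
  have ha0 : a 0 = A := by simp [a]
  have hσ0 : σ 0 = S := by simp [σ]
  have hq0 : q 0 = P := by
    simp only [q, ha0, hσ0]
    rw [← sub_eq_zero, ← neg_eq_zero, ← hSeq]
    abel
  have hσsym : ∀ t, (σ t)ᵀ = σ t := fun t => by simp [σ, eS]
  have hqsym : ∀ t, (q t)ᵀ = q t := fun t => by
    simp only [q, Matrix.transpose_sub, Matrix.transpose_mul, Matrix.transpose_transpose, hσsym]
    simp only [Matrix.mul_assoc]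
    abel
  have hσpos : ∀ᶠ t in 𝓝 (0 : ℝ), (σ t).PosDef := by
    have h := hS.eventually_posDef
    rw [← hσ0] at h
    filter_upwards [(hcσ.tendsto 0).eventually h] with t ht using ht (hσsym t)
  have hqpos : ∀ᶠ t in 𝓝 (0 : ℝ), (q t).PosDef := by
    have h := hP.eventually_posDef
    rw [← hq0] at h
    filter_upwards [(hcq.tendsto 0).eventually h] with t ht using ht (hqsym t)
  have hobs' : ∀ᶠ t in 𝓝 (0 : ℝ), IsObservablePair (a t) c := by
    simp only [← isControllablePair_transpose_iff]
    have hc : Continuous fun t : ℝ => ((a t)ᵀ, c) := by fun_prop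
    refine (isOpen_isControllablePair.preimage hc).mem_nhds ?_
    change IsControllablePair (a 0)ᵀ c
    rwa [ha0, isControllablePair_transpose_iff]
  have haff : ∀ (X Y : Matrix (Fin n) (Fin n) ℝ) (i j : Fin n),
      AnalyticOnNhd ℝ (fun t : ℝ => (X + t • Y) i j) Set.univ := fun X Y i j => by
    simp only [Matrix.add_apply, Matrix.smul_apply, smul_eq_mul]
    exact analyticOnNhd_const.add (analyticOnNhd_id.mul analyticOnNhd_const)
  have hctrl : ∀ᶠ t in 𝓝[≠] (0 : ℝ), IsControllablePair (a t) (σ t * c) := by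
    refine IsControllablePair.eventually_of_analytic (A := a) (B := fun t => σ t * c) (t₁ := 1)
      (haff A (Aᵀ - A)) (analyticOnNhd_matrix_mul (M := σ) (N := fun _ => c) (haff S (1 - S)) fun i j => analyticOnNhd_const) ?_ 0
    have h1 : a 1 = Aᵀ := by simp [a]
    have h2 : σ 1 = 1 := by simp [σ]
    rwa [h1, h2, Matrix.one_mul, isControllablePair_transpose_iff]
  have hlim : Tendsto (fun t => (a t, c, q t)) (𝓝[≠] (0 : ℝ)) (𝓝 (A, c, P)) := by
    have hc : Continuous fun t : ℝ => (a t, c, q t) := by fun_prop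
    have := (hc.tendsto 0).mono_left (nhdsWithin_le_nhds (s := {0}ᶜ))
    rwa [ha0, hq0] at this
  refine mem_closure_of_tendsto hlim ?_
  filter_upwards [hctrl, nhdsWithin_le_nhds hσpos, nhdsWithin_le_nhds hqpos,
    nhdsWithin_le_nhds hobs'] with t h1 h2 h3 h4
  refine ⟨⟨(a t, c, q t), h4, h3⟩, mem_regularTriplets_iff.2
    ⟨⟨h4, h3⟩, 1, one_pos, σ t, h2, ?_, h1⟩, rfl⟩
  simp only [one_smul, q]
  abel

end RegularTriplets

theorem mainTheorem7 (n p : ℕ) :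
    IsOpen {x : observableTriplets n p | x.1 ∈ regularTriplets n p} ∧
      Dense {x : observableTriplets n p | x.1 ∈ regularTriplets n p} :=
  ⟨isOpen_regularTriplets n p, dense_regularTriplets n p⟩
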